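/- Let $\lambda_E$ denote the uniform probability measure on a Borel set $E\subset\mathbb R^n$ with $0<|E|<\infty$. For a probability measure $\mu$ on $\mathbb R^n$ let $\mu^+(A)=\liminf_{\varepsilon\to0^+}\frac{\mu(A_\varepsilon)-\mu(A)}{\varepsilon}$ with $A_\varepsilon=\{x:\mathrm{dist}(x,A)<\varepsilon\}$, and let the Cheeger constant $D_{\mathrm{Che}}(\mu)$ be the largest $h$ with $\mu^+(A)\ge h\min\{\mu(A),1-\mu(A)\}$ for all Borel sets $A$. For a cost $c\ge 0$ let $\mathcal W_c(\mu,\nu)=\inf_\pi\iint c(x,y)\,d\pi(x,y)$ over all couplings $\pi$ of $\mu$ and $\nu$, and let $W_1=\mathcal W_c$ for $c(x,y)=|x-y|$. Put $\mathcal F(t)=t-\log(1+t)$ for $t\ge0$, $c_\mu(x,y)=\mathcal F(D_{\mathrm{Che}}(\mu)|x-y|)$, and $\widetilde E=|E|^{-1/n}E$. Let $p_K(E)=\liminf_{\varepsilon\to0^+}\frac{|E+\varepsilon K|-|E|}{\varepsilon}$, $R(E,K)=\frac{p_K(E)}{n|K|^{1/n}|E|^{1-1/n}}-1$, and $A_K(E)=\inf\left\{\frac{|E\,\Delta\,(x_0+rK)|}{|E|}: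 x_0\in\mathbb R^n,\ r>0,\ r^n|K|=|E|\right\}$. For $\alpha>0$ consider in $\mathbb R^2$ the rectangles $$E_\alpha=\left[-\tfrac{\alpha}{2},\tfrac{\alpha}{2}\right]\times\left[-\tfrac1{2\alpha},\tfrac1{2\alpha}\right],\qquad K_\alpha=\left[-\tfrac{\alpha^2}{2},\tfrac{\alpha^2}{2}\right]\times\left[-\tfrac1{2\alpha^2},\tfrac1{2\alpha^2}\right].$$ Then $$\lim_{\alpha\to+\infty}D_{\mathrm{Che}}(\lambda_{E_\alpha})\,W_1(\lambda_{E_\alpha},\lambda_{K_\alpha})=+\infty .$$ Hence, with $n=2$, for every constant $c>0$ the transport remainders $$\frac cn\,\mathcal F\big(D_{\mathrm{Che}}(\lambda_{E_\alpha})W_1(\lambda_{E_\alpha},\lambda_{K_\alpha})\big)\quad\text{and}\quad \frac cn\,\mathcal W_{c_{\lambda_{\widetilde E_\alpha}}}(\lambda_{\widetilde E_\alpha},\lambda_{\widetilde K_\alpha})$$ tend to $+\infty$ as $\alpha\to+\infty$, and so does $R(E_\alpha,K_\alpha)$; whereas for every constant $C\ge 0$ the Figalli--Maggi--Pratelli remainder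 $\frac{C}{n^7}A_{K_\alpha}(E_\alpha)^2$ stays bounded over all $\alpha>0$. -/

import Mathlib

open MeasureTheory Filter Topology Set
open scoped ENNReal NNReal Pointwise

namespace QuantIso

noncomputable section

/-- The uniform probability measure `λ_E` on `E ⊆ ℝⁿ`: normalized restricted Lebesgue measure. -/
def unif {n : ℕ} (E : Set (EuclideanSpace ℝ (Fin n))) : Measure (EuclideanSpace ℝ (Fin n)) :=
  (volume E)⁻¹ • volume.restrict E

/-- The Minkowski content `μ⁺(A) = liminf_{ε → 0⁺} (μ(A_ε) - μ(A)) / ε`, where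
`A_ε = {x | dist(x, A) < ε}`. -/
def minkowskiContent {n : ℕ} (μ : Measure (EuclideanSpace ℝ (Fin n)))
    (A : Set (EuclideanSpace ℝ (Fin n))) : ℝ≥0∞ :=
  liminf (fun ε : ℝ => (μ (Metric.thickening ε A) - μ A) / ENNReal.ofReal ε) (𝓝[>] 0)

/-- The Cheeger constant `D_Che(μ)`: the largest `h` such that
`h * min (μ A) (1 - μ A) ≤ μ⁺(A)` for all Borel sets `A`. -/
def cheeger {n : ℕ} (μ : Measure (EuclideanSpace ℝ (Fin n))) : ℝ≥0∞ :=
  sSup {h : ℝ≥0∞ | ∀ A : Set (EuclideanSpace ℝ (Fin n)), MeasurableSet A →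
    h * min (μ A) (1 - μ A) ≤ minkowskiContent μ A}

/-- The transportation cost `W_c(μ, ν)`: infimum of `∬ c(x, y) dπ(x, y)` over all `π` with
marginals `μ` and `ν`. -/
def transportCost {n : ℕ}
    (c : EuclideanSpace ℝ (Fin n) → EuclideanSpace ℝ (Fin n) → ℝ≥0∞)
    (μ ν : Measure (EuclideanSpace ℝ (Fin n))) : ℝ≥0∞ :=
  ⨅ (π : Measure (EuclideanSpace ℝ (Fin n) × EuclideanSpace ℝ (Fin n)))
    (_ : π.map Prod.fst = μ) (_ : π.map Prod.snd = ν), ∫⁻ p, c p.1 p.2 ∂π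

/-- The Wasserstein distance `W₁`, for the Euclidean distance. -/
def W1 {n : ℕ} (μ ν : Measure (EuclideanSpace ℝ (Fin n))) : ℝ≥0∞ :=
  transportCost (fun x y => edist x y) μ ν

/-- `F(t) = t - log (1 + t)` on `[0, ∞]`, with `F(∞) = ∞`. -/
def costF (t : ℝ≥0∞) : ℝ≥0∞ :=
  if t = ⊤ then ⊤ else ENNReal.ofReal (t.toReal - Real.log (1 + t.toReal))

/-- The cost `c_μ(x, y) = F(D_Che(μ) |y - x|)`. -/
def cheegerCost {n : ℕ} (μ : Measure (EuclideanSpace ℝ (Fin n)))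
    (x y : EuclideanSpace ℝ (Fin n)) : ℝ≥0∞ :=
  costF (cheeger μ * edist x y)

/-- The volume one homothetic copy `|E|^{-1/n} E` of `E`. -/
def normalized {n : ℕ} (E : Set (EuclideanSpace ℝ (Fin n))) : Set (EuclideanSpace ℝ (Fin n)) :=
  ((volume E).toReal ^ (-(1 / (n : ℝ)))) • E

/-- The transport remainder `(c / n) W_{c_μ}(μ, ν)`, where `μ`, `ν` are uniform on the volume one
copies of `E`, `K`. -/
def costRemainder {n : ℕ} (c : ℝ≥0) (E K : Set (EuclideanSpace ℝ (Fin n))) : ℝ≥0∞ :=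
  (c : ℝ≥0∞) / (n : ℝ≥0∞) *
    transportCost (cheegerCost (unif (normalized E))) (unif (normalized E)) (unif (normalized K))

/-- The remainder `(c / n) F(D_Che(λ_E) W₁(λ_E, λ_K))`. -/
def distRemainder {n : ℕ} (c : ℝ≥0) (E K : Set (EuclideanSpace ℝ (Fin n))) : ℝ≥0∞ :=
  (c : ℝ≥0∞) / (n : ℝ≥0∞) * costF (cheeger (unif E) * W1 (unif E) (unif K))

/-- The anisotropic perimeter `p_K(E) = liminf_{ε → 0⁺} (|E + ε K| - |E|) / ε`. -/
def perimeter {n : ℕ} (K E : Set (EuclideanSpace ℝ (Fin n))) : ℝ≥0∞ :=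
  liminf (fun ε : ℝ => (volume (E + ε • K) - volume E) / ENNReal.ofReal ε) (𝓝[>] 0)

/-- The isoperimetric deficit `R(E, K) = p_K(E) / (n |K|^{1/n} |E|^{1 - 1/n}) - 1`. -/
def deficit {n : ℕ} (E K : Set (EuclideanSpace ℝ (Fin n))) : ℝ :=
  (perimeter K E).toReal /
    (n * (volume K).toReal ^ (1 / (n : ℝ)) * (volume E).toReal ^ (1 - 1 / (n : ℝ))) - 1

/-- The asymmetry index
`A_K(E) = inf {|E Δ (x₀ + r K)| / |E| : x₀ ∈ ℝⁿ, r > 0, r^n |K| = |E|}`. -/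
def asymmetry {n : ℕ} (K E : Set (EuclideanSpace ℝ (Fin n))) : ℝ≥0∞ :=
  ⨅ (x₀ : EuclideanSpace ℝ (Fin n)) (r : ℝ) (_ : 0 < r)
    (_ : ENNReal.ofReal r ^ n * volume K = volume E),
    volume (symmDiff E (x₀ +ᵥ r • K)) / volume E

/-- The Figalli-Maggi-Pratelli remainder `(C / n^7) A_K(E)^2`. -/
def fmpRemainder {n : ℕ} (C : ℝ≥0) (E K : Set (EuclideanSpace ℝ (Fin n))) : ℝ≥0∞ :=
  (C : ℝ≥0∞) / (n : ℝ≥0∞) ^ 7 * asymmetry K E ^ 2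

/-- The rectangle `E_α = [-α/2, α/2] × [-1/(2α), 1/(2α)]`. -/
def rectE (α : ℝ) : Set (EuclideanSpace ℝ (Fin 2)) :=
  {x | x 0 ∈ Icc (-(α / 2)) (α / 2) ∧ x 1 ∈ Icc (-(1 / (2 * α))) (1 / (2 * α))}

/-- The rectangle `K_α = [-α²/2, α²/2] × [-1/(2α²), 1/(2α²)]`. -/
def rectK (α : ℝ) : Set (EuclideanSpace ℝ (Fin 2)) :=
  {x | x 0 ∈ Icc (-(α ^ 2 / 2)) (α ^ 2 / 2) ∧
    x 1 ∈ Icc (-(1 / (2 * α ^ 2))) (1 / (2 * α ^ 2))}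

end

end QuantIso

/-! Both rectangles have area one. The Cheeger constant of `rectE α` is at least `1 / (8 α)`, while
a quarter of `rectK α` lies at distance at least `α² / 4 - α / 2` from `rectE α`. The product of the
two bounds grows linearly in `α`. Since `F(t) ≥ t / 2 - 1 / 2`, both transport remainders inherit
linear lower bounds (`le_transportCost_box`, `ofReal_le_costF`).

The Cheeger bound (`le_cheeger_box`) needs no convex-geometric input. Join `p ∈ A` to `q` outside
the `ε`-neighbourhood `T` of `A` by an axis-parallel path with one corner. Either the corner lies in
`T \ A`, or one leg lies on a line that meets both `A` and `Tᶜ` and hence crosses `T \ A` along a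
length of at least `ε`. Integrating over pairs bounds `ε |A| |Tᶜ|` by a multiple of `|T \ A|`
(`ofReal_mul_prod_mul_le`).

The Minkowski sum of two such rectangles is a rectangle, which makes the deficit explicit. The
asymmetry of sets of unit volume never exceeds 2. -/

namespace QuantIso

/-! ### Separation inequalities on an interval and in a product of intervals -/

/-- If `S` meets `[x, z]` at `x` and `z` is at distance at least `ε` from `S`, then a gap of length
`ε` separates `S` from `z`. -/
theorem exists_Ioo_gap {S : Set ℝ} {ε x z : ℝ} (hx : x ∈ S) (hxz : x ≤ z)
    (hz : ∀ s ∈ S, ε ≤ |z - s|) :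
    ∃ p, x ≤ p ∧ p + ε ≤ z ∧ ∀ y ∈ Ioo p (p + ε), y ∉ S ∧ ∃ s ∈ S, |y - s| < ε := by
  have hne : (S ∩ Icc x z).Nonempty := ⟨x, hx, le_rfl, hxz⟩
  have hbdd : BddAbove (S ∩ Icc x z) := ⟨z, fun y hy => hy.2.2⟩
  have hle : ∀ s ∈ S ∩ Icc x z, s ≤ z - ε := fun s hs => by
    have := hz s hs.1
    rw [abs_of_nonneg (sub_nonneg.2 hs.2.2)] at this
    linarith
  have hsup : sSup (S ∩ Icc x z) ≤ z - ε := csSup_le hne hle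
  have hxs : x ≤ sSup (S ∩ Icc x z) := le_csSup hbdd ⟨hx, le_rfl, hxz⟩
  -- The gap starts at the supremum of `S` below `z`: no point of `S` lies between it and `z`, and
  -- points of `S` come arbitrarily close to it from the left.
  refine ⟨sSup (S ∩ Icc x z), hxs, by linarith, fun y hy => ⟨fun hyS => ?_, ?_⟩⟩
  · have := le_csSup hbdd (⟨hyS, by linarith [hy.1], by linarith [hy.2]⟩ : y ∈ S ∩ Icc x z)
    linarith [hy.1]
  · obtain ⟨s, hs, hlt⟩ := exists_lt_of_lt_csSup hne (b := y - ε) (by linarith [hy.2])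
    refine ⟨s, hs.1, abs_lt.2 ⟨?_, by linarith⟩⟩
    linarith [le_csSup hbdd hs, hy.1, hy.2]

/-- A nonempty part of an interval and a nonempty part outside of its `ε`-neighbourhood are
separated by a set of length at least `ε`. -/
theorem ofReal_le_volume_restrict_diff {S T : Set ℝ} {u v ε x z : ℝ}
    (hST : ∀ s ∈ S, ∀ y, |y - s| < ε → y ∈ T) (hx : x ∈ S) (hxI : x ∈ Icc u v)
    (hz : z ∉ T) (hzI : z ∈ Icc u v) :
    ENNReal.ofReal ε ≤ volume.restrict (Icc u v) (T \ S) := by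
  have key : ∃ p, u ≤ p ∧ p + ε ≤ v ∧ ∀ y ∈ Ioo p (p + ε), y ∉ S ∧ ∃ s ∈ S, |y - s| < ε := by
    have hzS : ∀ s ∈ S, ε ≤ |z - s| := fun s hs => not_lt.1 fun h => hz (hST s hs z h)
    rcases le_total x z with h | h
    · obtain ⟨p, h1, h2, h3⟩ := exists_Ioo_gap hx h hzS
      exact ⟨p, hxI.1.trans h1, h2.trans hzI.2, h3⟩
    -- The case `z ≤ x` follows by reflection.
    · obtain ⟨p, h1, h2, h3⟩ := exists_Ioo_gap (S := -S) (x := -x) (z := -z) (ε := ε)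
        (by simpa using hx) (neg_le_neg h) (fun s hs => by
          have := hzS (-s) hs
          rwa [← abs_neg, show -(-z - s) = z - -s by ring])
      refine ⟨-(p + ε), by linarith [hzI.1], by linarith [hxI.2], fun y hy => ?_⟩
      obtain ⟨h4, s, hs, h5⟩ := h3 (-y) ⟨by linarith [hy.2], by linarith [hy.1]⟩
      refine ⟨fun hyS => h4 (by simpa using hyS), -s, hs, ?_⟩
      rwa [← abs_neg, show -(y - -s) = -y - s by ring]
  obtain ⟨p, h1, h2, h3⟩ := key
  have hsub : Ioo p (p + ε) ⊆ (T \ S) ∩ Icc u v := fun y hy => by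
    obtain ⟨h4, s, hs, h5⟩ := h3 y hy
    exact ⟨⟨hST s hs y h5, h4⟩, by linarith [hy.1], by linarith [hy.2]⟩
  calc ENNReal.ofReal ε = volume (Ioo p (p + ε)) := by simp
    _ ≤ volume ((T \ S) ∩ Icc u v) := measure_mono hsub
    _ ≤ _ := Measure.le_restrict_apply _ _

/-- If the interval meets both `S` and `Tᶜ`, the gap supplies `ε` and each measure is at most `v -
u`; otherwise the left side vanishes. -/
theorem ofReal_mul_volume_restrict_mul_le {S T : Set ℝ} {u v ε : ℝ}
    (hST : ∀ s ∈ S, ∀ y, |y - s| < ε → y ∈ T) :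
    ENNReal.ofReal ε * (volume.restrict (Icc u v) S * volume.restrict (Icc u v) Tᶜ) ≤
      ENNReal.ofReal (v - u) ^ 2 * volume.restrict (Icc u v) (T \ S) := by
  have hle : ∀ B : Set ℝ, volume.restrict (Icc u v) B ≤ ENNReal.ofReal (v - u) := fun B => by
    calc _ ≤ volume.restrict (Icc u v) univ := measure_mono (subset_univ _)
      _ = _ := by simp
  by_cases hS : (S ∩ Icc u v).Nonempty
  · by_cases hT : (Tᶜ ∩ Icc u v).Nonempty
    · obtain ⟨x, hx, hxI⟩ := hS
      obtain ⟨z, hz, hzI⟩ := hT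
      rw [mul_comm, sq]
      exact mul_le_mul' (mul_le_mul' (hle _) (hle _))
        (ofReal_le_volume_restrict_diff hST hx hxI hz hzI)
    · have : volume.restrict (Icc u v) Tᶜ = 0 := by
        rw [Measure.restrict_apply' measurableSet_Icc, not_nonempty_iff_eq_empty.1 hT, measure_empty]
      simp [this]
  · have : volume.restrict (Icc u v) S = 0 := by
      rw [Measure.restrict_apply' measurableSet_Icc, not_nonempty_iff_eq_empty.1 hS, measure_empty]
    simp [this]

/-- Separation inequality in a product of two intervals: sets `A ⊆ T` such that `T` contains the
axis-parallel `ε`-neighbourhoods of `A`. -/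
theorem ofReal_mul_prod_mul_le {A T : Set (ℝ × ℝ)} {u v u' v' ε : ℝ}
    (hA : MeasurableSet A) (hT : MeasurableSet T)
    (h₁ : ∀ p ∈ A, ∀ y, |y - p.1| < ε → (y, p.2) ∈ T)
    (h₂ : ∀ p ∈ A, ∀ y, |y - p.2| < ε → (p.1, y) ∈ T) :
    ENNReal.ofReal ε *
      (((volume.restrict (Icc u v)).prod (volume.restrict (Icc u' v'))) A *
        ((volume.restrict (Icc u v)).prod (volume.restrict (Icc u' v'))) Tᶜ) ≤
      ENNReal.ofReal (v - u) * ENNReal.ofReal (v' - u') *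
        (ENNReal.ofReal (v - u) + ENNReal.ofReal (v' - u') + ENNReal.ofReal ε) *
        ((volume.restrict (Icc u v)).prod (volume.restrict (Icc u' v'))) (T \ A) := by
  set μ := (volume : Measure ℝ).restrict (Icc u v)
  set ν := (volume : Measure ℝ).restrict (Icc u' v')
  set a := ENNReal.ofReal (v - u)
  set b := ENNReal.ofReal (v' - u')
  set e := ENNReal.ofReal ε
  set f : ℝ → ℝ≥0∞ := fun t => μ ((fun s => (s, t)) ⁻¹' A)
  set h : ℝ → ℝ≥0∞ := fun s => ν (Prod.mk s ⁻¹' Tᶜ)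
  have hf : Measurable f := measurable_measure_prodMk_right hA
  have hh : Measurable h := measurable_measure_prodMk_left hT.compl
  have hfa : ∀ t, f t ≤ a := fun t => by
    calc f t ≤ μ univ := measure_mono (subset_univ _)
      _ = a := by simp [μ, a]
  have hhb : ∀ s, h s ≤ b := fun s => by
    calc h s ≤ ν univ := measure_mono (subset_univ _)
      _ = b := by simp [ν, b]
  -- The product over pairs `p ∈ A`, `q ∈ Tᶜ` becomes an integral over the corner `z = (q.1, p.2)`:
  -- `f z.2` measures the possible `p`, `h z.1` the possible `q`.
  have hprod : μ.prod ν A * μ.prod ν Tᶜ = ∫⁻ z, h z.1 * f z.2 ∂μ.prod ν := by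
    rw [lintegral_prod_mul hh.aemeasurable hf.aemeasurable, Measure.prod_apply hT.compl,
      Measure.prod_apply_symm hA, mul_comm]
  -- The corner lies in `Tᶜ` (the horizontal leg crosses), in `A` (the vertical leg crosses), or in
  -- `T \ A`.
  have hpt : ∀ z : ℝ × ℝ, h z.1 * f z.2 ≤
      b * (Tᶜ.indicator (fun z => f z.2) z) + a * (A.indicator (fun z => h z.1) z) +
        a * b * ((T \ A).indicator 1 z) := fun z => by
    by_cases hzT : z ∈ T
    · by_cases hzA : z ∈ A
      · refine le_trans ?_ (le_trans le_add_self le_self_add)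
        rw [indicator_of_mem hzA, mul_comm]
        exact mul_le_mul_left (hfa _) _
      · refine le_trans ?_ le_add_self
        rw [indicator_of_mem (show z ∈ T \ A from ⟨hzT, hzA⟩), mul_comm]
        simpa using mul_le_mul' (hfa _) (hhb _)
    · refine le_trans ?_ (le_trans le_self_add le_self_add)
      rw [indicator_of_mem (show z ∈ Tᶜ from hzT)]
      exact mul_le_mul_left (hhb _) _
  have hm1 : Measurable (Tᶜ.indicator (fun z : ℝ × ℝ => f z.2)) :=
    (hf.comp measurable_snd).indicator hT.compl
  have hm2 : Measurable (A.indicator (fun z : ℝ × ℝ => h z.1)) :=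
    (hh.comp measurable_fst).indicator hA
  have hI1 : e * ∫⁻ z, Tᶜ.indicator (fun z => f z.2) z ∂μ.prod ν ≤ a ^ 2 * μ.prod ν (T \ A) := by
    rw [lintegral_prod_symm _ hm1.aemeasurable, Measure.prod_apply_symm (hT.diff hA),
      ← lintegral_const_mul' _ _ (by simp [e]), ← lintegral_const_mul' _ _ (by simp [a])]
    refine lintegral_mono fun t => ?_
    have : ∀ s, Tᶜ.indicator (fun z : ℝ × ℝ => f z.2) (s, t) =
        ((fun s => (s, t)) ⁻¹' Tᶜ).indicator (fun _ => f t) s := fun s => rfl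
    simp only [this]
    rw [lintegral_indicator_const (measurable_prodMk_right hT.compl)]
    exact ofReal_mul_volume_restrict_mul_le fun s hs y hy => h₁ _ hs y hy
  have hI2 : e * ∫⁻ z, A.indicator (fun z => h z.1) z ∂μ.prod ν ≤ b ^ 2 * μ.prod ν (T \ A) := by
    rw [lintegral_prod _ hm2.aemeasurable, Measure.prod_apply (hT.diff hA),
      ← lintegral_const_mul' _ _ (by simp [e]), ← lintegral_const_mul' _ _ (by simp [b])]
    refine lintegral_mono fun s => ?_
    have : ∀ t, A.indicator (fun z : ℝ × ℝ => h z.1) (s, t) =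
        (Prod.mk s ⁻¹' A).indicator (fun _ => h s) t := fun t => rfl
    simp only [this]
    rw [lintegral_indicator_const (measurable_prodMk_left hA), mul_comm (h s)]
    exact ofReal_mul_volume_restrict_mul_le fun t ht y hy => h₂ _ ht y hy
  calc e * (μ.prod ν A * μ.prod ν Tᶜ)
      ≤ e * ∫⁻ z, b * (Tᶜ.indicator (fun z => f z.2) z) + a * (A.indicator (fun z => h z.1) z) +
        a * b * ((T \ A).indicator 1 z) ∂μ.prod ν := by
        rw [hprod]
        exact mul_le_mul_right (lintegral_mono hpt) _
    _ = b * (e * ∫⁻ z, Tᶜ.indicator (fun z => f z.2) z ∂μ.prod ν) +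
        a * (e * ∫⁻ z, A.indicator (fun z => h z.1) z ∂μ.prod ν) +
        a * b * (e * μ.prod ν (T \ A)) := by
        rw [lintegral_add_left (f := fun z : ℝ × ℝ => b * (Tᶜ.indicator (fun z => f z.2) z) +
            a * (A.indicator (fun z => h z.1) z)) ((hm1.const_mul b).add (hm2.const_mul a)),
          lintegral_add_left (hm1.const_mul _), lintegral_const_mul _ hm1,
          lintegral_const_mul _ hm2, lintegral_const_mul' _ _ (by finiteness),
          lintegral_indicator_one (hT.diff hA)]
        ring
    _ ≤ b * (a ^ 2 * μ.prod ν (T \ A)) + a * (b ^ 2 * μ.prod ν (T \ A)) +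
        a * b * (e * μ.prod ν (T \ A)) := by gcongr
    _ = _ := by ring

/-! ### Rectangles in the Euclidean plane -/

/-- The rectangle `[-a, a] × [-b, b]`. -/
def box (a b : ℝ) : Set (EuclideanSpace ℝ (Fin 2)) :=
  {x | x 0 ∈ Icc (-a) a ∧ x 1 ∈ Icc (-b) b}

/-- The plane as a product of two lines. -/
noncomputable def planeEquiv : EuclideanSpace ℝ (Fin 2) ≃ᵐ ℝ × ℝ :=
  (MeasurableEquiv.toLp 2 (Fin 2 → ℝ)).symm.trans MeasurableEquiv.finTwoArrow

theorem planeEquiv_apply (x : EuclideanSpace ℝ (Fin 2)) : planeEquiv x = (x 0, x 1) := rfl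

theorem measurePreserving_planeEquiv : MeasurePreserving planeEquiv volume volume :=
  (volume_preserving_finTwoArrow ℝ).comp (EuclideanSpace.volume_preserving_symm_measurableEquiv_toLp _)

theorem box_eq_preimage (a b : ℝ) : box a b = planeEquiv ⁻¹' (Icc (-a) a ×ˢ Icc (-b) b) := rfl

theorem measurableSet_box (a b : ℝ) : MeasurableSet (box a b) := by
  rw [box_eq_preimage]
  exact planeEquiv.measurable (measurableSet_Icc.prod measurableSet_Icc)

theorem volume_box (a b : ℝ) :
    volume (box a b) = ENNReal.ofReal (2 * a) * ENNReal.ofReal (2 * b) := by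
  rw [box_eq_preimage, measurePreserving_planeEquiv.measure_preimage_equiv, Measure.volume_eq_prod,
    Measure.prod_prod, Real.volume_Icc, Real.volume_Icc]
  congr 2 <;> ring

theorem map_restrict_box (a b : ℝ) : (volume.restrict (box a b)).map planeEquiv =
    (volume.restrict (Icc (-a) a)).prod (volume.restrict (Icc (-b) b)) := by
  rw [Measure.prod_restrict, ← Measure.volume_eq_prod, box_eq_preimage,
    ← measurePreserving_planeEquiv.map_eq,
    Measure.restrict_map planeEquiv.measurable (measurableSet_Icc.prod measurableSet_Icc)]

theorem volume_preimage_planeEquiv_Icc (u v u' v' : ℝ) :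
    volume (planeEquiv ⁻¹' (Icc u v ×ˢ Icc u' v')) =
      ENNReal.ofReal (v - u) * ENNReal.ofReal (v' - u') := by
  rw [measurePreserving_planeEquiv.measure_preimage_equiv, Measure.volume_eq_prod,
    Measure.prod_prod, Real.volume_Icc, Real.volume_Icc]

theorem abs_sub_apply_le_dist (x y : EuclideanSpace ℝ (Fin 2)) (i : Fin 2) :
    |x i - y i| ≤ dist x y := by
  rw [dist_eq_norm, ← Real.norm_eq_abs]
  exact PiLp.norm_apply_le (x - y) i

theorem dist_planeEquiv_symm_fst (s t t' : ℝ) :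
    dist (planeEquiv.symm (s, t)) (planeEquiv.symm (s, t')) = |t - t'| := by
  rw [EuclideanSpace.dist_eq]
  simp [planeEquiv, Real.sqrt_sq_eq_abs, Real.dist_eq]

theorem dist_planeEquiv_symm_snd (s s' t : ℝ) :
    dist (planeEquiv.symm (s, t)) (planeEquiv.symm (s', t)) = |s - s'| := by
  rw [EuclideanSpace.dist_eq]
  simp [planeEquiv, Real.sqrt_sq_eq_abs, Real.dist_eq]

/-! ### Bounds for the Cheeger constant of a rectangle -/

theorem min_one_sub_le (x : ℝ≥0∞) : min x (1 - x) ≤ 2 * (x * (1 - x)) := by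
  have h2 : (2 : ℝ≥0∞) * 2⁻¹ = 1 := ENNReal.mul_inv_cancel (by simp) (by simp)
  rcases le_total x 2⁻¹ with h | h
  · have : 2⁻¹ ≤ 1 - x := by
      rw [← ENNReal.one_sub_inv_two]
      exact tsub_le_tsub_left h 1
    calc min x (1 - x) ≤ x := min_le_left _ _
      _ = 2 * (x * 2⁻¹) := by rw [mul_left_comm, h2, mul_one]
      _ ≤ _ := by gcongr
  · calc min x (1 - x) ≤ 1 - x := min_le_right _ _
      _ = 2 * (2⁻¹ * (1 - x)) := by rw [← mul_assoc, h2, one_mul]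
      _ ≤ _ := by gcongr

theorem ofReal_mul_volume_box_mul_le {a b ε : ℝ} {A : Set (EuclideanSpace ℝ (Fin 2))}
    (hA : MeasurableSet A) :
    ENNReal.ofReal ε * (volume.restrict (box a b) A *
        volume.restrict (box a b) (Metric.thickening ε A)ᶜ) ≤
      volume (box a b) * (ENNReal.ofReal (2 * a) + ENNReal.ofReal (2 * b) + ENNReal.ofReal ε) *
        volume.restrict (box a b) (Metric.thickening ε A \ A) := by
  have hT : MeasurableSet (Metric.thickening ε A) := Metric.isOpen_thickening.measurableSet
  have hmap : ∀ B : Set (EuclideanSpace ℝ (Fin 2)), volume.restrict (box a b) B =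
      ((volume.restrict (Icc (-a) a)).prod (volume.restrict (Icc (-b) b)))
        (planeEquiv.symm ⁻¹' B) := fun B => by
    rw [← map_restrict_box, planeEquiv.map_apply, ← preimage_comp, planeEquiv.symm_comp_self,
      preimage_id]
  have key := ofReal_mul_prod_mul_le (A := planeEquiv.symm ⁻¹' A)
    (T := planeEquiv.symm ⁻¹' (Metric.thickening ε A)) (u := -a) (v := a) (u' := -b) (v' := b)
    (ε := ε) (planeEquiv.symm.measurable hA) (planeEquiv.symm.measurable hT)
    (fun p hp y hy => Metric.mem_thickening_iff.2 ⟨_, hp, by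
      rwa [← Prod.mk.eta (p := p), dist_planeEquiv_symm_snd]⟩)
    (fun p hp y hy => Metric.mem_thickening_iff.2 ⟨_, hp, by
      rwa [← Prod.mk.eta (p := p), dist_planeEquiv_symm_fst]⟩)
  rw [sub_neg_eq_add, sub_neg_eq_add, ← two_mul, ← two_mul] at key
  rw [hmap, hmap, hmap, volume_box]
  exact key

theorem unif_eq_restrict {n : ℕ} {E : Set (EuclideanSpace ℝ (Fin n))} (hE : volume E = 1) :
    unif E = volume.restrict E := by
  rw [unif, hE, inv_one, one_smul]

/-- The separation inequality controls `μ A * μ Tᶜ`, with `T` the `ε`-thickening. Replacing `Tᶜ` by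
`Aᶜ` costs only the layer `T \ A`, and `min_one_sub_le` turns the product into the minimum. -/
theorem le_cheeger_box {a b : ℝ} (hab : volume (box a b) = 1) :
    (2 * (ENNReal.ofReal (2 * a) + ENNReal.ofReal (2 * b) + 2))⁻¹ ≤ cheeger (unif (box a b)) := by
  refine le_sSup fun A hA => ?_
  rw [unif_eq_restrict hab]
  set μ := volume.restrict (box a b)
  set L := ENNReal.ofReal (2 * a) + ENNReal.ofReal (2 * b)
  have hμ : μ univ = 1 := by simp [μ, hab]
  have : IsProbabilityMeasure μ := ⟨hμ⟩
  refine le_liminf_of_le (by isBoundedDefault) ?_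
  filter_upwards [Ioo_mem_nhdsGT (show (0 : ℝ) < 1 from one_pos)] with ε hε
  have hε1 : ENNReal.ofReal ε ≤ 1 := by simpa using hε.2.le
  have hε0 : ENNReal.ofReal ε ≠ 0 := by simpa using hε.1
  have hsub : A ⊆ Metric.thickening ε A := Metric.self_subset_thickening hε.1 A
  have hδ : μ (Metric.thickening ε A) - μ A = μ (Metric.thickening ε A \ A) :=
    (measure_sdiff hsub hA.nullMeasurableSet (measure_ne_top _ _)).symm
  have hsplit : 1 - μ A ≤ μ (Metric.thickening ε A)ᶜ + μ (Metric.thickening ε A \ A) := by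
    rw [← prob_compl_eq_one_sub hA]
    refine le_trans (measure_mono fun x hx => ?_) (measure_union_le _ _)
    by_cases h : x ∈ Metric.thickening ε A
    · exact Or.inr ⟨h, hx⟩
    · exact Or.inl h
  have key := ofReal_mul_volume_box_mul_le (a := a) (b := b) (ε := ε) hA
  rw [hab, one_mul] at key
  rw [hδ, ENNReal.le_div_iff_mul_le (Or.inl hε0) (Or.inl (by simp)), mul_assoc,
    ENNReal.inv_mul_le_iff (by simp) (by simp [L, ENNReal.mul_eq_top])]
  calc min (μ A) (1 - μ A) * ENNReal.ofReal ε
      ≤ 2 * (μ A * (μ (Metric.thickening ε A)ᶜ + μ (Metric.thickening ε A \ A))) *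
        ENNReal.ofReal ε := by
        gcongr
        exact (min_one_sub_le _).trans (by gcongr)
    _ = 2 * (ENNReal.ofReal ε * (μ A * μ (Metric.thickening ε A)ᶜ)) +
        2 * (μ A * ENNReal.ofReal ε * μ (Metric.thickening ε A \ A)) := by ring
    -- With `ε ≤ 1`, the separation inequality contributes `L + 1` and the layer contributes another
    -- `1`.
    _ ≤ 2 * ((L + 1) * μ (Metric.thickening ε A \ A)) +
        2 * (1 * 1 * μ (Metric.thickening ε A \ A)) := by
        refine add_le_add (mul_le_mul_right (key.trans (mul_le_mul_left ?_ _)) _)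
          (mul_le_mul_right (mul_le_mul_left (mul_le_mul' prob_le_one hε1) _) _)
        exact add_le_add le_rfl hε1
    _ = _ := by ring

/-- The half-plane `x 0 ≤ 0` has mass `1 / 2` and Minkowski content at most the height `2 b`, so
every admissible `h` is at most `4 b`. -/
theorem cheeger_box_ne_top {a b : ℝ} (ha : 0 ≤ a) (hab : volume (box a b) = 1) :
    cheeger (unif (box a b)) ≠ ⊤ := by
  set A : Set (EuclideanSpace ℝ (Fin 2)) := planeEquiv ⁻¹' (Iic 0 ×ˢ univ)
  have hA : MeasurableSet A := planeEquiv.measurable (measurableSet_Iic.prod MeasurableSet.univ)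
  have hμA : unif (box a b) A = 2⁻¹ := by
    have hinter : A ∩ box a b = planeEquiv ⁻¹' (Icc (-a) 0 ×ˢ Icc (-b) b) := by
      ext x
      simp only [A, box, mem_inter_iff, mem_preimage, planeEquiv_apply, mem_prod, mem_Iic, mem_univ,
        mem_ofPred_eq, mem_Icc]
      constructor
      · tauto
      · exact fun h => ⟨⟨h.1.2, trivial⟩, ⟨h.1.1, h.1.2.trans ha⟩, h.2⟩
    rw [volume_box, ENNReal.ofReal_mul zero_le_two, ENNReal.ofReal_ofNat, mul_assoc] at hab
    rw [unif_eq_restrict (by rw [volume_box, ENNReal.ofReal_mul zero_le_two, ENNReal.ofReal_ofNat,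
      mul_assoc, hab]), Measure.restrict_apply hA, hinter, volume_preimage_planeEquiv_Icc,
      zero_sub, neg_neg, sub_neg_eq_add, ← two_mul]
    exact ENNReal.eq_inv_of_mul_eq_one_left (by rw [mul_comm, hab])
  have hcontent : minkowskiContent (unif (box a b)) A ≤ ENNReal.ofReal (2 * b) := by
    refine liminf_le_of_frequently_le' (Eventually.frequently ?_)
    filter_upwards [self_mem_nhdsWithin] with ε (hε : 0 < ε)
    rw [ENNReal.div_le_iff (by simpa using hε) (by simp), unif_eq_restrict hab]
    refine le_measure_sdiff.trans ?_
    rw [Measure.restrict_apply' (measurableSet_box a b)]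
    calc _ ≤ volume (planeEquiv ⁻¹' (Icc 0 ε ×ˢ Icc (-b) b)) := by
          refine measure_mono fun x hx => ?_
          obtain ⟨⟨hxT, hxA⟩, hx0, hx1⟩ := hx
          obtain ⟨y, hy, hxy⟩ := Metric.mem_thickening_iff.1 hxT
          have hx0' : 0 ≤ x 0 := by
            by_contra h
            exact hxA ⟨(not_le.1 h).le, trivial⟩
          have hy0 : y 0 ≤ 0 := hy.1
          have := (le_abs_self _).trans (abs_sub_apply_le_dist x y 0)
          exact ⟨⟨hx0', by simp only [planeEquiv_apply]; linarith⟩, hx1⟩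
      _ = _ := by
          rw [volume_preimage_planeEquiv_Icc, sub_zero, sub_neg_eq_add, ← two_mul, mul_comm]
  refine ne_top_of_le_ne_top (b := 2 * ENNReal.ofReal (2 * b)) (by finiteness) (sSup_le fun h hh => ?_)
  have := (hh A hA).trans hcontent
  rw [hμA, ENNReal.one_sub_inv_two, min_self] at this
  calc h = 2 * (h * 2⁻¹) := by
        rw [mul_left_comm, ENNReal.mul_inv_cancel (by simp) (by simp), mul_one]
    _ ≤ _ := by gcongr

/-! ### Transport costs between bounded sets -/

theorem ae_mem_unif {n : ℕ} {E : Set (EuclideanSpace ℝ (Fin n))} (hE : MeasurableSet E) :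
    ∀ᵐ x ∂unif E, x ∈ E :=
  Measure.ae_smul_measure (ae_restrict_mem hE) _

theorem isProbabilityMeasure_unif {n : ℕ} {E : Set (EuclideanSpace ℝ (Fin n))}
    (hE : volume E = 1) : IsProbabilityMeasure (unif E) := by
  rw [unif_eq_restrict hE]
  exact ⟨by simp [hE]⟩

theorem isBounded_box (a b : ℝ) : Bornology.IsBounded (box a b) := by
  refine Metric.isBounded_closedBall (x := (0 : EuclideanSpace ℝ (Fin 2))) (r := a + b) |>.subset
    fun x hx => ?_
  have h0 := abs_le.2 hx.1
  have h1 := abs_le.2 hx.2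
  rw [mem_closedBall_zero_iff, EuclideanSpace.norm_eq, Fin.sum_univ_two, Real.norm_eq_abs,
    Real.norm_eq_abs]
  refine (Real.sqrt_le_left (by positivity)).2 ?_ |>.trans (add_le_add h0 h1)
  nlinarith [abs_nonneg (x 0), abs_nonneg (x 1)]

/-- The product coupling bounds a monotone transportation cost between bounded sets. -/
theorem transportCost_le_diam {n : ℕ} {E K : Set (EuclideanSpace ℝ (Fin n))} (g : ℝ≥0∞ → ℝ≥0∞)
    (hg : Monotone g) (hE : MeasurableSet E) (hK : MeasurableSet K) (hE1 : volume E = 1)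
    (hK1 : volume K = 1) :
    transportCost (fun x y => g (edist x y)) (unif E) (unif K) ≤ g (Metric.ediam (E ∪ K)) := by
  have := isProbabilityMeasure_unif hE1
  have := isProbabilityMeasure_unif hK1
  refine iInf_le_of_le ((unif E).prod (unif K)) (iInf_le_of_le (by simp [Measure.map_fst_prod])
    (iInf_le_of_le (by simp [Measure.map_snd_prod]) ?_))
  calc _ ≤ ∫⁻ _, g (Metric.ediam (E ∪ K)) ∂(unif E).prod (unif K) := by
        refine lintegral_mono_ae ?_
        filter_upwards [Measure.quasiMeasurePreserving_fst.ae (ae_mem_unif hE),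
          Measure.quasiMeasurePreserving_snd.ae (ae_mem_unif hK)] with p h1 h2
        exact hg (Metric.edist_le_ediam_of_mem (Or.inl h1) (Or.inr h2))
    _ = _ := by simp

/-- A quarter of the longer of two rectangles of unit area has to be moved by a long way. -/
theorem le_transportCost_box {a b c d : ℝ} (g : ℝ≥0∞ → ℝ≥0∞) (hg : Monotone g)
    (hc : 0 ≤ c) (hcd : volume (box c d) = 1) :
    4⁻¹ * g (ENNReal.ofReal (c / 2 - a)) ≤
      transportCost (fun x y => g (edist x y)) (unif (box a b)) (unif (box c d)) := by
  refine le_iInf fun π => le_iInf fun h1 => le_iInf fun h2 => ?_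
  -- The rightmost quarter of the target: its points have first coordinate at least `c / 2`, those
  -- of the source at most `a`.
  set S : Set (EuclideanSpace ℝ (Fin 2)) := planeEquiv ⁻¹' (Icc (c / 2) c ×ˢ Icc (-d) d)
  have hS : MeasurableSet S := planeEquiv.measurable (measurableSet_Icc.prod measurableSet_Icc)
  have hSsub : S ⊆ box c d := fun x hx =>
    ⟨⟨(by linarith : -c ≤ c / 2).trans hx.1.1, hx.1.2⟩, hx.2⟩
  have hS4 : π (Prod.snd ⁻¹' S) = 4⁻¹ := by
    rw [← Measure.map_apply measurable_snd hS, h2, unif_eq_restrict hcd, Measure.restrict_apply hS,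
      inter_eq_self_of_subset_left hSsub, volume_preimage_planeEquiv_Icc]
    refine ENNReal.eq_inv_of_mul_eq_one_left ?_
    rw [← hcd, volume_box, sub_neg_eq_add, ← two_mul, mul_right_comm,
      ← ENNReal.ofReal_ofNat 4, ← ENNReal.ofReal_mul (by linarith)]
    congr 2
    ring
  have hE : ∀ᵐ p ∂π, p.1 ∈ box a b := by
    refine ae_of_ae_map measurable_fst.aemeasurable (p := fun x => x ∈ box a b) ?_
    rw [h1]
    exact ae_mem_unif (measurableSet_box a b)
  calc 4⁻¹ * g (ENNReal.ofReal (c / 2 - a))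
      = ∫⁻ p, (Prod.snd ⁻¹' S).indicator (fun _ => g (ENNReal.ofReal (c / 2 - a))) p ∂π := by
        rw [lintegral_indicator_const (measurable_snd hS), hS4, mul_comm]
    _ ≤ _ := by
        refine lintegral_mono_ae ?_
        filter_upwards [hE] with p hp
        by_cases hpS : p ∈ Prod.snd ⁻¹' S
        · rw [indicator_of_mem hpS, edist_comm, edist_dist]
          refine hg (ENNReal.ofReal_le_ofReal ?_)
          have h3 : c / 2 ≤ p.2 0 := hpS.1.1
          have h4 := (le_abs_self _).trans (abs_sub_apply_le_dist p.2 p.1 0)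
          linarith [hp.1.2]
        · rw [indicator_of_notMem hpS]
          exact zero_le

/-! ### Monotonicity and linear growth of `F` -/

/-- The tangent to the logarithm at 2, together with `log 2 ≤ 1`. -/
theorem log_one_add_le {t : ℝ} (ht : 0 ≤ t) : Real.log (1 + t) ≤ t / 2 + 1 / 2 := by
  have h1 := Real.log_le_sub_one_of_pos (show 0 < (1 + t) / 2 by linarith)
  rw [Real.log_div (by linarith) two_ne_zero] at h1
  linarith [Real.log_two_lt_d9]

theorem monotone_costF : Monotone costF := by
  intro s t hst
  by_cases ht : t = ⊤
  · simp [costF, ht]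
  have hs : s ≠ ⊤ := ne_top_of_le_ne_top ht hst
  rw [costF, costF, if_neg ht, if_neg hs]
  refine ENNReal.ofReal_le_ofReal ?_
  have h0 : 0 ≤ s.toReal := ENNReal.toReal_nonneg
  have hle := ENNReal.toReal_mono ht hst
  have hpos : 0 < 1 + t.toReal := by linarith
  -- For `s ≤ t`, the logarithm grows by at most `(t - s) / (1 + s) ≤ t - s`.
  have h1 := Real.log_le_sub_one_of_pos (show 0 < (1 + t.toReal) / (1 + s.toReal) by positivity)
  rw [Real.log_div (by positivity) (by positivity)] at h1
  have h2 : (1 + t.toReal) / (1 + s.toReal) ≤ 1 + (t.toReal - s.toReal) := by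
    rw [div_le_iff₀ (by positivity)]
    nlinarith
  linarith

theorem costF_ne_top {t : ℝ≥0∞} (ht : t ≠ ⊤) : costF t ≠ ⊤ := by
  rw [costF, if_neg ht]
  exact ENNReal.ofReal_ne_top

theorem ofReal_le_costF {l : ℝ} {t : ℝ≥0∞} (h : ENNReal.ofReal l ≤ t) :
    ENNReal.ofReal (l / 2 - 1 / 2) ≤ costF t := by
  refine le_trans ?_ (monotone_costF h)
  rw [costF, if_neg ENNReal.ofReal_ne_top]
  refine ENNReal.ofReal_le_ofReal ?_
  have := log_one_add_le (ENNReal.toReal_nonneg (a := ENNReal.ofReal l))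
  have h2 : l ≤ (ENNReal.ofReal l).toReal := by
    rw [ENNReal.toReal_ofReal']
    exact le_max_left _ _
  linarith

/-- Finiteness is needed because `toReal` sends `⊤` to `0`. -/
theorem tendsto_toReal_atTop {f : ℝ → ℝ≥0∞} {l : ℝ → ℝ} (hl : Tendsto l atTop atTop)
    (hf : ∀ᶠ α in atTop, ENNReal.ofReal (l α) ≤ f α ∧ f α ≠ ⊤) :
    Tendsto (fun α => (f α).toReal) atTop atTop :=
  tendsto_atTop_mono' _ (hf.mono fun _ h => (ENNReal.ofReal_le_iff_le_toReal h.2).1 h.1) hl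

/-! ### Estimates for `E_α` and `K_α` -/

theorem rectE_eq_box (α : ℝ) : rectE α = box (α / 2) (1 / (2 * α)) := rfl

theorem rectK_eq_rectE (α : ℝ) : rectK α = rectE (α ^ 2) := rfl

theorem measurableSet_rectE (α : ℝ) : MeasurableSet (rectE α) := measurableSet_box _ _

theorem volume_rectE {α : ℝ} (hα : 0 < α) : volume (rectE α) = 1 := by
  rw [rectE_eq_box, volume_box, ← ENNReal.ofReal_mul (by positivity)]
  field_simp
  simp

theorem normalized_eq_self {n : ℕ} {E : Set (EuclideanSpace ℝ (Fin n))} (hE : volume E = 1) :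
    normalized E = E := by
  rw [normalized, hE, ENNReal.toReal_one, Real.one_rpow, one_smul]

theorem ofReal_le_cheeger_rectE {α : ℝ} (hα : 1 ≤ α) :
    ENNReal.ofReal (1 / (8 * α)) ≤ cheeger (unif (rectE α)) := by
  refine le_trans ?_ (le_cheeger_box (volume_rectE (one_pos.trans_le hα)))
  rw [one_div, ENNReal.ofReal_inv_of_pos (by positivity), ENNReal.inv_le_inv,
    ← ENNReal.ofReal_ofNat 2, ← ENNReal.ofReal_add (by positivity) (by positivity),
    ← ENNReal.ofReal_add (by positivity) (by positivity), ← ENNReal.ofReal_mul (by positivity)]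
  refine ENNReal.ofReal_le_ofReal ?_
  -- For `α ≥ 1`, `2 (α + 1 / α + 2) ≤ 2 α + 6 ≤ 8 α`.
  have : 1 / (2 * α) ≤ 1 / 2 := by gcongr; linarith
  linarith

theorem cheeger_rectE_ne_top {α : ℝ} (hα : 0 < α) : cheeger (unif (rectE α)) ≠ ⊤ :=
  cheeger_box_ne_top (by positivity) (volume_rectE hα)

theorem le_transportCost_rect {α : ℝ} (hα : 0 < α) (g : ℝ≥0∞ → ℝ≥0∞) (hg : Monotone g) :
    4⁻¹ * g (ENNReal.ofReal (α ^ 2 / 4 - α / 2)) ≤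
      transportCost (fun x y => g (edist x y)) (unif (rectE α)) (unif (rectK α)) := by
  rw [show α ^ 2 / 4 - α / 2 = α ^ 2 / 2 / 2 - α / 2 by ring]
  exact le_transportCost_box g hg (by positivity) (volume_rectE (by positivity : 0 < α ^ 2))

theorem transportCost_rect_ne_top {α : ℝ} (hα : 0 < α) (g : ℝ≥0∞ → ℝ≥0∞) (hg : Monotone g)
    (hg' : ∀ t, t ≠ ⊤ → g t ≠ ⊤) :
    transportCost (fun x y => g (edist x y)) (unif (rectE α)) (unif (rectK α)) ≠ ⊤ :=
  ne_top_of_le_ne_top (hg' _ ((isBounded_box _ _).union (isBounded_box _ _)).ediam_ne_top)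
    (transportCost_le_diam g hg (measurableSet_rectE α) (measurableSet_rectE (α ^ 2))
      (volume_rectE hα) (volume_rectE (by positivity)))

theorem W1_rect_ne_top {α : ℝ} (hα : 0 < α) : W1 (unif (rectE α)) (unif (rectK α)) ≠ ⊤ :=
  transportCost_rect_ne_top hα id monotone_id fun _ h => h

theorem ofReal_le_cheeger_mul {α : ℝ} (hα : 1 ≤ α) :
    ENNReal.ofReal (α / 32 - 1 / 16) ≤
      cheeger (unif (rectE α)) * ENNReal.ofReal (α ^ 2 / 4 - α / 2) := by
  have h0 : 0 < α := one_pos.trans_le hα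
  refine le_trans ?_ (mul_le_mul_left (ofReal_le_cheeger_rectE hα) _)
  rw [← ENNReal.ofReal_mul (by positivity)]
  refine ENNReal.ofReal_le_ofReal (le_of_eq ?_)
  field_simp
  ring

theorem ofReal_le_cheeger_mul_W1 {α : ℝ} (hα : 1 ≤ α) :
    ENNReal.ofReal ((α / 32 - 1 / 16) / 4) ≤
      cheeger (unif (rectE α)) * W1 (unif (rectE α)) (unif (rectK α)) := by
  have h := le_transportCost_rect (one_pos.trans_le hα) id monotone_id
  refine le_trans ?_ (mul_le_mul_right h _)
  rw [id, mul_left_comm, ENNReal.ofReal_div_of_pos (by norm_num), ENNReal.div_eq_inv_mul,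
    ENNReal.ofReal_ofNat]
  gcongr
  exact ofReal_le_cheeger_mul hα

/-! ### Deficit and asymmetry -/

theorem smul_box_add {a b c d ε : ℝ} (ha : 0 < a) (hb : 0 < b) (hc : 0 < c) (hd : 0 < d)
    (hε : 0 < ε) : box a b + ε • box c d = box (a + ε * c) (b + ε * d) := by
  ext x
  rw [Set.mem_add]
  constructor
  · rintro ⟨y, hy, _, ⟨z, hz, rfl⟩, rfl⟩
    obtain ⟨⟨h1, h2⟩, h3, h4⟩ := hy
    obtain ⟨⟨h5, h6⟩, h7, h8⟩ := hz
    refine ⟨⟨?_, ?_⟩, ?_, ?_⟩ <;> simp only [PiLp.add_apply, PiLp.smul_apply, smul_eq_mul] <;>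
      nlinarith
  · intro hx
    -- Each coordinate `t` of the sum is split in the ratio `p : ε q`.
    have key : ∀ {p q t : ℝ}, 0 < p → 0 < q → t ∈ Icc (-(p + ε * q)) (p + ε * q) →
        p * (t / (p + ε * q)) ∈ Icc (-p) p ∧ q * (t / (p + ε * q)) ∈ Icc (-q) q ∧
          p * (t / (p + ε * q)) + ε * (q * (t / (p + ε * q))) = t := by
      intro p q t hp hq ht
      have h : 0 < p + ε * q := by positivity
      have h1 : -1 ≤ t / (p + ε * q) := by rw [le_div_iff₀ h]; linarith [ht.1]
      have h2 : t / (p + ε * q) ≤ 1 := by rw [div_le_iff₀ h]; linarith [ht.2]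
      refine ⟨⟨by nlinarith, by nlinarith⟩, ⟨by nlinarith, by nlinarith⟩, ?_⟩
      field_simp
    obtain ⟨h1, h2, h3⟩ := key ha hc hx.1
    obtain ⟨h4, h5, h6⟩ := key hb hd hx.2
    refine ⟨!₂[_, _], ⟨h1, h4⟩, _, smul_mem_smul_set (a := ε) (⟨h2, h5⟩ : !₂[_, _] ∈ box c d), ?_⟩
    ext i
    fin_cases i
    · exact h3
    · exact h6

theorem perimeter_rect {α : ℝ} (hα : 0 < α) :
    perimeter (rectK α) (rectE α) = ENNReal.ofReal (α + 1 / α) := by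
  have h : Tendsto (fun ε : ℝ => ENNReal.ofReal (α + 1 / α + ε)) (𝓝[>] 0)
      (𝓝 (ENNReal.ofReal (α + 1 / α))) := by
    have : Tendsto (fun ε : ℝ => α + 1 / α + ε) (𝓝 0) (𝓝 (α + 1 / α)) :=
      (continuous_const.add continuous_id).tendsto' _ _ (by simp)
    exact (ENNReal.continuous_ofReal.tendsto _).comp (this.mono_left nhdsWithin_le_nhds)
  -- For `ε > 0` the difference quotient is exactly `α + 1 / α + ε`.
  refine Tendsto.liminf_eq (h.congr' ?_)
  filter_upwards [self_mem_nhdsWithin] with ε (hε : 0 < ε)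
  rw [volume_rectE hα, rectK_eq_rectE, rectE_eq_box, rectE_eq_box, smul_box_add (by positivity)
    (by positivity) (by positivity) (by positivity) hε, volume_box,
    ← ENNReal.ofReal_mul (by positivity), ← ENNReal.ofReal_one, ← ENNReal.ofReal_sub _ zero_le_one,
    ← ENNReal.ofReal_div_of_pos hε]
  congr 1
  field_simp
  ring

theorem deficit_rect {α : ℝ} (hα : 0 < α) :
    deficit (rectE α) (rectK α) = (α + 1 / α) / 2 - 1 := by
  rw [deficit, perimeter_rect hα, rectK_eq_rectE, volume_rectE hα, volume_rectE (by positivity),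
    ENNReal.toReal_ofReal (by positivity), ENNReal.toReal_one, Real.one_rpow, Real.one_rpow]
  simp

theorem asymmetry_le_two {n : ℕ} {E K : Set (EuclideanSpace ℝ (Fin n))} (hE : volume E = 1)
    (hK : volume K = 1) : asymmetry K E ≤ 2 := by
  refine iInf_le_of_le 0 (iInf_le_of_le 1 (iInf_le_of_le one_pos
    (iInf_le_of_le (by simp [hE, hK]) ?_)))
  rw [zero_vadd, one_smul, hE, div_one]
  calc volume (symmDiff E K) ≤ volume (E ∪ K) := measure_mono symmDiff_le_sup
    _ ≤ volume E + volume K := measure_union_le _ _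
    _ = 2 := by rw [hE, hK, one_add_one_eq_two]

/-! ### Limits of the remainders -/

theorem tendsto_affine_atTop {p : ℝ} (hp : 0 < p) (q : ℝ) :
    Tendsto (fun α : ℝ => p * α - q) atTop atTop :=
  tendsto_atTop_add_const_right _ (-q) (tendsto_id.const_mul_atTop hp)

theorem coe_div_two (c : ℝ≥0) : (c : ℝ≥0∞) / ((2 : ℕ) : ℝ≥0∞) = ENNReal.ofReal (c / 2) := by
  rw [ENNReal.ofReal_div_of_pos two_pos, ENNReal.ofReal_coe_nnreal]
  simp

theorem tendsto_cheeger_mul_W1 :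
    Tendsto (fun α : ℝ => (cheeger (unif (rectE α)) *
      W1 (unif (rectE α)) (unif (rectK α))).toReal) atTop atTop := by
  refine tendsto_toReal_atTop (l := fun α => (α / 32 - 1 / 16) / 4) ?_ ?_
  · exact (tendsto_affine_atTop (p := 1 / 128) (by norm_num) (1 / 64)).congr fun α => by ring
  · filter_upwards [eventually_ge_atTop 1] with α hα
    have h0 : 0 < α := one_pos.trans_le hα
    exact ⟨ofReal_le_cheeger_mul_W1 hα,
      ENNReal.mul_ne_top (cheeger_rectE_ne_top h0) (W1_rect_ne_top h0)⟩

theorem tendsto_distRemainder {c : ℝ≥0} (hc : 0 < c) :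
    Tendsto (fun α : ℝ => (distRemainder c (rectE α) (rectK α)).toReal) atTop atTop := by
  have hc' : (0 : ℝ) < c := hc
  refine tendsto_toReal_atTop (l := fun α => c / 2 * ((α / 32 - 1 / 16) / 4 / 2 - 1 / 2)) ?_ ?_
  · exact (tendsto_affine_atTop (p := c / 512) (by positivity)
      (c / 256 + c / 4)).congr fun α => by ring
  · filter_upwards [eventually_ge_atTop 1] with α hα
    have h0 : 0 < α := one_pos.trans_le hα
    rw [distRemainder, coe_div_two]
    refine ⟨?_, ENNReal.mul_ne_top ENNReal.ofReal_ne_top (costF_ne_top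
      (ENNReal.mul_ne_top (cheeger_rectE_ne_top h0) (W1_rect_ne_top h0)))⟩
    rw [ENNReal.ofReal_mul (by positivity)]
    gcongr
    exact ofReal_le_costF (ofReal_le_cheeger_mul_W1 hα)

theorem tendsto_costRemainder {c : ℝ≥0} (hc : 0 < c) :
    Tendsto (fun α : ℝ => (costRemainder c (rectE α) (rectK α)).toReal) atTop atTop := by
  have hc' : (0 : ℝ) < c := hc
  refine tendsto_toReal_atTop (l := fun α => c / 2 * (4⁻¹ * ((α / 32 - 1 / 16) / 2 - 1 / 2))) ?_ ?_
  · exact (tendsto_affine_atTop (p := c / 512) (by positivity)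
      (c / 256 + c / 16)).congr fun α => by ring
  · filter_upwards [eventually_ge_atTop 1] with α hα
    have h0 : 0 < α := one_pos.trans_le hα
    -- The Cheeger cost is a monotone function `g` of the distance, as the transport bounds require.
    obtain ⟨g, hg⟩ : ∃ g : ℝ≥0∞ → ℝ≥0∞, ∀ t, g t = costF (cheeger (unif (rectE α)) * t) :=
      ⟨_, fun _ => rfl⟩
    have hmono : Monotone g := fun s t hst => by
      rw [hg, hg]
      exact monotone_costF (mul_le_mul_right hst _)
    have hcost : cheegerCost (unif (rectE α)) = fun x y => g (edist x y) := by
      ext x y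
      rw [hg, cheegerCost]
    rw [costRemainder, coe_div_two, normalized_eq_self (volume_rectE h0), rectK_eq_rectE,
      normalized_eq_self (volume_rectE (pow_pos h0 2)), ← rectK_eq_rectE, hcost]
    refine ⟨?_, ENNReal.mul_ne_top ENNReal.ofReal_ne_top (transportCost_rect_ne_top h0 g hmono
      fun t ht => ?_)⟩
    · rw [ENNReal.ofReal_mul (by positivity)]
      refine mul_le_mul_right (le_trans ?_ (le_transportCost_rect h0 g hmono)) _
      rw [ENNReal.ofReal_mul (by positivity), ENNReal.ofReal_inv_of_pos (by norm_num),
        ENNReal.ofReal_ofNat, hg]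
      exact mul_le_mul_right (ofReal_le_costF (ofReal_le_cheeger_mul hα)) _
    · rw [hg]
      exact costF_ne_top (ENNReal.mul_ne_top (cheeger_rectE_ne_top h0) ht)

theorem tendsto_deficit_rect :
    Tendsto (fun α : ℝ => deficit (rectE α) (rectK α)) atTop atTop := by
  refine tendsto_atTop_mono' _ ?_ (tendsto_affine_atTop (p := 1 / 2) (by norm_num) 1)
  filter_upwards [eventually_gt_atTop 0] with α hα
  rw [deficit_rect hα]
  have : 0 < 1 / α := by positivity
  linarith

theorem exists_fmpRemainder_rect_le (C : ℝ≥0) :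
    ∃ M : ℝ≥0, ∀ α : ℝ, 0 < α → fmpRemainder C (rectE α) (rectK α) ≤ M := by
  have hM : (C : ℝ≥0∞) / ((2 : ℕ) : ℝ≥0∞) ^ 7 * 2 ^ 2 ≠ ⊤ :=
    ENNReal.mul_ne_top (ENNReal.div_ne_top ENNReal.coe_ne_top (by simp)) (by simp)
  refine ⟨((C : ℝ≥0∞) / ((2 : ℕ) : ℝ≥0∞) ^ 7 * 2 ^ 2).toNNReal, fun α hα => ?_⟩
  rw [ENNReal.coe_toNNReal hM, fmpRemainder]
  gcongr
  exact asymmetry_le_two (volume_rectE hα) (volume_rectE (by positivity : 0 < α ^ 2))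

end QuantIso

/-- The limits are taken of real numbers: since `∞.toReal = 0`, each of the first three limits also
contains the finiteness of its quantity for all large `α`. -/
theorem mainTheorem3 :
    Tendsto (fun α : ℝ =>
      (QuantIso.cheeger (QuantIso.unif (QuantIso.rectE α)) *
        QuantIso.W1 (QuantIso.unif (QuantIso.rectE α))
          (QuantIso.unif (QuantIso.rectK α))).toReal) atTop atTop ∧
    (∀ c : ℝ≥0, 0 < c →
      Tendsto (fun α : ℝ =>
        (QuantIso.distRemainder c (QuantIso.rectE α) (QuantIso.rectK α)).toReal) atTop atTop ∧
      Tendsto (fun α : ℝ =>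
        (QuantIso.costRemainder c (QuantIso.rectE α) (QuantIso.rectK α)).toReal) atTop atTop) ∧
    Tendsto (fun α : ℝ => QuantIso.deficit (QuantIso.rectE α) (QuantIso.rectK α)) atTop atTop ∧
    (∀ C : ℝ≥0, ∃ M : ℝ≥0, ∀ α : ℝ, 0 < α →
      QuantIso.fmpRemainder C (QuantIso.rectE α) (QuantIso.rectK α) ≤ (M : ℝ≥0∞)) := by
  exact ⟨QuantIso.tendsto_cheeger_mul_W1, fun _ hc => ⟨QuantIso.tendsto_distRemainder hc,
    QuantIso.tendsto_costRemainder hc⟩, QuantIso.tendsto_deficit_rect,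
    QuantIso.exists_fmpRemainder_rect_le⟩
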